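/- An N-step is a nonempty set of integers; an N-walk of length $n$ is a sequence $w=(w_1,\dots,w_n)$ of N-steps. A classical walk $v=(v_1,\dots,v_n)\in\mathbb Z^n$ starts at $0$, has ordinates $v_1+\dots+v_j$ ($0\le j\le n$) and endpoint $v_1+\dots+v_n$; it is a meander if all its ordinates are nonnegative, and an excursion if moreover its endpoint is $0$. The walk $v$ is compatible with $w$ if $v_i\in w_i$ for all $i$. An N-meander (resp. N-excursion) is an N-walk compatible with at least one meander (resp. excursion). For an N-meander $w$, let $\operatorname{reach}^+(w)$ be the set of endpoints of the meanders compatible with $w$, and let $\min^+(w)$, $\max^+(w)$ be its minimum and maximum. The N-meander $w$ is of type $1$ if $\operatorname{reach}^+(w)=\{\min^+(w),\min^+(w)+2,\dots,\max^+(w)\}$, and of type $2$ if $\operatorname{reach}^+(w)=\{\min^+(w),\min^+(w)+1,\dots,\max^+(w)\}$ and $\max^+(w)-\min^+(w)\ge 1$. A Motzkin N-walk is an N-walk all of whose N-steps are nonempty subsets of $\{-1,0,1\}$. Theorem. Let $K$ be a field of characteristic $0$ and let $p_s\in K$ be arbitrary weights, one for each of the seven nonempty subsets $s$ of $\{-1,0,1\}$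 (for example, all equal to $1$). Write $p(w)=\prod_{i=1}^{n}p_{w_i}$ for a Motzkin N-walk $w$ of length $|w|=n$. Then the generating functions of Motzkin N-meanders and of Motzkin N-excursions, $$\sum_{w\ \text{Motzkin N-meander}}p(w)\,t^{|w|},\qquad \sum_{w\ \text{Motzkin N-excursion}}p(w)\,t^{|w|}\qquad\in K[[t]],$$ are algebraic over $K(t)$. Moreover the refined generating functions of Motzkin N-meanders, $$\sum_{w\ \text{Motzkin N-meander}}p(w)\,x^{\min^+(w)}y^{\max^+(w)}t^{|w|},$$ $$M_1^+(x,y;t)=\sum_{w\ \text{of type }1}p(w)\,x^{\min^+(w)}y^{\max^+(w)}t^{|w|},\qquad M_2^+(x,y;t)=\sum_{w\ \text{of type }2}p(w)\,x^{\min^+(w)}y^{\max^+(w)-1}t^{|w|}$$ (in the last two, $w$ runs over the Motzkin N-meanders of the given type), which are power series in $t$ with coefficients in $K[x,y]$, are algebraic over $K(x,y,t)$. -/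

import Mathlib

noncomputable section

namespace NWalk

/-- A walk `v` of length `n` (starting at the origin) is a meander if all its ordinates
`v₁ + ⋯ + v_j`, `0 ≤ j ≤ n`, are nonnegative. -/
def IsMeander {n : ℕ} (v : Fin n → ℤ) : Prop :=
  ∀ j : Fin (n + 1), 0 ≤ Fin.partialSum v j

/-- An excursion is a meander with endpoint `0`. -/
def IsExcursion {n : ℕ} (v : Fin n → ℤ) : Prop :=
  IsMeander v ∧ ∑ i, v i = 0

/-- The N-walk `w` and the walk `v` (of the same length) are compatible. -/
def Compatible {n : ℕ} (w : Fin n → Finset ℤ) (v : Fin n → ℤ) : Prop :=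
  ∀ i, v i ∈ w i

/-- An N-meander is an N-walk compatible with at least one meander. -/
def IsNMeander {n : ℕ} (w : Fin n → Finset ℤ) : Prop :=
  ∃ v, Compatible w v ∧ IsMeander v

/-- An N-excursion is an N-walk compatible with at least one excursion. -/
def IsNExcursion {n : ℕ} (w : Fin n → Finset ℤ) : Prop :=
  ∃ v, Compatible w v ∧ IsExcursion v

/-- The reachable points of an N-meander: the endpoints of the compatible meanders. -/
def reachPlus {n : ℕ} (w : Fin n → Finset ℤ) : Set ℤ :=
  {r | ∃ v, Compatible w v ∧ IsMeander v ∧ ∑ i, v i = r}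

/-- The minimum reachable point. It is only used for N-meanders; their set of reachable points
is nonempty and finite, so that the infimum is attained. -/
def minPlus {n : ℕ} (w : Fin n → Finset ℤ) : ℤ := sInf (reachPlus w)

/-- The maximum reachable point. It is only used for N-meanders; their set of reachable points
is nonempty and finite, so that the supremum is attained. -/
def maxPlus {n : ℕ} (w : Fin n → Finset ℤ) : ℤ := sSup (reachPlus w)

/-- N-meanders of type 1: the reachable points are `min, min + 2, min + 4, …, max`. -/
def IsNMeanderType1 {n : ℕ} (w : Fin n → Finset ℤ) : Prop :=
  IsNMeander w ∧ reachPlus w = {r | minPlus w ≤ r ∧ r ≤ maxPlus w ∧ 2 ∣ r - minPlus w}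

/-- N-meanders of type 2: the reachable points are `min, min + 1, min + 2, …, max`,
and `max - min ≥ 1`. -/
def IsNMeanderType2 {n : ℕ} (w : Fin n → Finset ℤ) : Prop :=
  IsNMeander w ∧ reachPlus w = {r | minPlus w ≤ r ∧ r ≤ maxPlus w} ∧
    1 ≤ maxPlus w - minPlus w

/-- The Motzkin N-steps: all nonempty subsets of `{-1, 0, 1}`. -/
def motzkinNSteps : Finset (Finset ℤ) :=
  (({-1, 0, 1} : Finset ℤ).powerset).erase ∅

/-- The Motzkin N-walks of length `n`. -/
def motzkinNWalks (n : ℕ) : Finset (Fin n → Finset ℤ) :=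
  Fintype.piFinset fun _ => motzkinNSteps

variable {K : Type*} [Field K]

/-- The weight of an N-walk is the product of the weights of its N-steps. -/
def weight (p : Finset ℤ → K) {n : ℕ} (w : Fin n → Finset ℤ) : K := ∏ i, p (w i)

/-- The monomial `c * x ^ a * y ^ b` in `K[x, y]`. -/
def xyMonomial (c : K) (a b : ℤ) : MvPolynomial (Fin 2) K :=
  MvPolynomial.C c * MvPolynomial.X 0 ^ a.toNat * MvPolynomial.X 1 ^ b.toNat

open Classical in
/-- The series `∑ weight(w) x ^ min⁺(w) y ^ max⁺(w) t ^ |w|` in `K[x, y][[t]]`,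
over all Motzkin N-meanders `w`. -/
def meanderSeriesXY (p : Finset ℤ → K) : PowerSeries (MvPolynomial (Fin 2) K) :=
  PowerSeries.mk fun n => ∑ w ∈ motzkinNWalks n with IsNMeander w,
    xyMonomial (weight p w) (minPlus w) (maxPlus w)

open Classical in
/-- The series `∑ weight(w) x ^ min⁺(w) y ^ max⁺(w) t ^ |w|` in `K[x, y][[t]]`,
over the Motzkin N-meanders `w` of type 1. -/
def meanderSeriesType1 (p : Finset ℤ → K) : PowerSeries (MvPolynomial (Fin 2) K) :=
  PowerSeries.mk fun n => ∑ w ∈ motzkinNWalks n with IsNMeanderType1 w,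
    xyMonomial (weight p w) (minPlus w) (maxPlus w)

open Classical in
/-- The series `∑ weight(w) x ^ min⁺(w) y ^ (max⁺(w) - 1) t ^ |w|` in `K[x, y][[t]]`,
over the Motzkin N-meanders `w` of type 2. -/
def meanderSeriesType2 (p : Finset ℤ → K) : PowerSeries (MvPolynomial (Fin 2) K) :=
  PowerSeries.mk fun n => ∑ w ∈ motzkinNWalks n with IsNMeanderType2 w,
    xyMonomial (weight p w) (minPlus w) (maxPlus w - 1)

open Classical in
/-- The series `∑ weight(w) t ^ |w|` in `K[[t]]`, over all Motzkin N-meanders `w`. -/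
def meanderSeries (p : Finset ℤ → K) : PowerSeries K :=
  PowerSeries.mk fun n => ∑ w ∈ motzkinNWalks n with IsNMeander w, weight p w

open Classical in
/-- The series `∑ weight(w) t ^ |w|` in `K[[t]]`, over all Motzkin N-excursions `w`. -/
def excursionSeries (p : Finset ℤ → K) : PowerSeries K :=
  PowerSeries.mk fun n => ∑ w ∈ motzkinNWalks n with IsNExcursion w, weight p w

end NWalk

end

/-! ### Reachable sets as states of an automaton with two counters. -/

namespace NWalk

/-! The reachable set after a step depends only on the previous reachable set and that step, and
Motzkin N-steps preserve the three shapes of `ReachState` (`mem_toSet_move`). The five series thus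
count paths of an automaton with two counters, with z = xy marking the minimum, u = y² the
half-width of `even` and y the excess width of `full`.

Removing the last step gives two linear functional equations, `stateSum_evenAll` and
`stateSum_fullAll`, whose unknowns include boundary series with minimum 0. `stateSum` is linear over
R⟦X⟧ and accepts marking functions with values in R⟦X⟧, so arbitrary power series may be substituted
for z, u and y.

The kernel method then applies. Substituting suitable series makes the coefficients of chosen
unknowns vanish; `mem_of_kernel_equations` finds the weight a of the walks ending in the state {0},
and `mem_of_functional_equations` recovers everything else by division. The substituted series solve
systems v = X · P(v); such a system has a power series solution by X-adic contraction, and the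
solution is algebraic by the Jacobian criterion, its Jacobian being the identity modulo X
(`exists_isAlgebraic_solution`). -/

/-- The possible reachable sets of a Motzkin N-walk: the empty set, the progressions
`{m, m + 2, …, m + 2k}`, and the intervals `{m, m + 1, …, m + e + 1}`. -/
inductive ReachState
  | dead
  | even (m k : ℕ)
  | full (m e : ℕ)

namespace ReachState

/-- The reachable set described by a state. -/
def toSet : ReachState → Set ℤ
  | dead => ∅
  | even m k => {r | (m : ℤ) ≤ r ∧ r ≤ m + 2 * k ∧ 2 ∣ r - m}
  | full m e => {r | (m : ℤ) ≤ r ∧ r ≤ m + e + 1}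

/-- The effect of an N-step on a state; the three Boolean values tell
whether `-1`, `0` and `1` belong to the N-step. -/
def move : Bool → Bool → Bool → ReachState → ReachState
  | _, _, _, dead => dead
  | false, false, false, _ => dead
  | false, true, false, σ => σ
  | false, false, true, even m k => even (m + 1) k
  | false, false, true, full m e => full (m + 1) e
  | false, true, true, even m k => full m (2 * k)
  | false, true, true, full m e => full m (e + 1)
  | true, false, false, even (m + 1) k => even m k
  | true, false, false, even 0 (k + 1) => even 1 k
  | true, false, false, even 0 0 => dead
  | true, false, false, full (m + 1) e => full m e
  | true, false, false, full 0 (e + 1) => full 0 e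
  | true, false, false, full 0 0 => even 0 0
  | true, true, false, even (m + 1) k => full m (2 * k)
  | true, true, false, even 0 (k + 1) => full 0 (2 * k + 1)
  | true, true, false, even 0 0 => even 0 0
  | true, true, false, full (m + 1) e => full m (e + 1)
  | true, true, false, full 0 e => full 0 e
  | true, false, true, even (m + 1) k => even m (k + 1)
  | true, false, true, even 0 k => even 1 k
  | true, false, true, full (m + 1) e => full m (e + 2)
  | true, false, true, full 0 e => full 0 (e + 1)
  | true, true, true, even (m + 1) k => full m (2 * k + 1)
  | true, true, true, even 0 k => full 0 (2 * k)
  | true, true, true, full (m + 1) e => full m (e + 2)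
  | true, true, true, full 0 e => full 0 (e + 1)

/-- The effect of a Motzkin N-step on a state. -/
def step (s : Finset ℤ) : ReachState → ReachState :=
  move (decide (-1 ∈ s)) (decide (0 ∈ s)) (decide (1 ∈ s))

/-- The shapes are closed under steps: a finite check, where splitting each counter into zero and
successor separates the cases in which the barrier at 0 truncates the set. -/
theorem mem_toSet_move (l c u : Bool) (σ : ReachState) (r : ℤ) :
    r ∈ (move l c u σ).toSet ↔ 0 ≤ r ∧ ((l = true ∧ r + 1 ∈ σ.toSet) ∨
      (c = true ∧ r ∈ σ.toSet) ∨ (u = true ∧ r - 1 ∈ σ.toSet)) := by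
  rcases l <;> rcases c <;> rcases u <;> rcases σ with _ | ⟨_ | m, _ | k⟩ | ⟨_ | m, _ | e⟩ <;>
    simp only [move, toSet, Set.mem_empty_iff_false, Set.mem_ofPred_eq] <;> push_cast <;>
    first | omega | grind

end ReachState

theorem motzkinNSteps_eq : motzkinNSteps =
    {{-1}, {0}, {1}, {-1, 0}, {0, 1}, {-1, 1}, {-1, 0, 1}} := by decide

theorem sum_motzkinNSteps {M : Type*} [AddCommMonoid M] (f : Finset ℤ → M) :
    ∑ s ∈ motzkinNSteps, f s = f {-1} + (f {0} + (f {1} + (f {-1, 0} + (f {0, 1} +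
      (f {-1, 1} + f {-1, 0, 1}))))) := by
  rw [motzkinNSteps_eq]
  repeat rw [Finset.sum_insert (by decide)]
  rw [Finset.sum_singleton]

theorem ReachState.mem_toSet_step {s : Finset ℤ} (hs : s ∈ motzkinNSteps) (σ : ReachState)
    (r : ℤ) : r ∈ (σ.step s).toSet ↔ 0 ≤ r ∧ ∃ e ∈ s, r - e ∈ σ.toSet := by
  have hsub : ∀ e ∈ s, e = -1 ∨ e = 0 ∨ e = 1 := by
    intro e he
    simpa using Finset.mem_powerset.1 (Finset.mem_of_mem_erase hs) he
  rw [step, mem_toSet_move]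
  refine and_congr_right fun _ => ⟨?_, ?_⟩
  · rintro (⟨h, h'⟩ | ⟨h, h'⟩ | ⟨h, h'⟩)
    · exact ⟨-1, of_decide_eq_true h, by simpa using h'⟩
    · exact ⟨0, of_decide_eq_true h, by simpa using h'⟩
    · exact ⟨1, of_decide_eq_true h, by simpa using h'⟩
  · rintro ⟨e, he, h⟩
    rcases hsub e he with rfl | rfl | rfl <;> simp_all

theorem isMeander_succ_iff {n : ℕ} (v : Fin (n + 1) → ℤ) :
    IsMeander v ↔ IsMeander (Fin.init v) ∧ 0 ≤ ∑ i, v i := by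
  have hlast : Fin.partialSum v (Fin.last (n + 1)) = ∑ i, v i := by
    rw [Fin.partialSum, Fin.val_last, List.take_of_length_le (by simp), List.sum_ofFn]
  unfold IsMeander
  rw [Fin.forall_fin_succ', hlast]
  simp only [Fin.partialSum_init]

/-- The Markov property that allows reachable sets to serve as states. -/
theorem mem_reachPlus_succ_iff {n : ℕ} (w : Fin (n + 1) → Finset ℤ) (r : ℤ) :
    r ∈ reachPlus w ↔ 0 ≤ r ∧ ∃ e ∈ w (Fin.last n), r - e ∈ reachPlus (Fin.init w) := by
  constructor
  · rintro ⟨v, hv, hm, rfl⟩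
    rw [isMeander_succ_iff] at hm
    refine ⟨hm.2, v (Fin.last n), hv _, Fin.init v, fun i => hv _, hm.1, ?_⟩
    rw [Fin.sum_univ_castSucc]
    simp [Fin.init]
  · rintro ⟨hr, e, he, v, hv, hm, hsum⟩
    have hs : ∑ i, (Fin.snoc v e : Fin (n + 1) → ℤ) i = r := by
      rw [Fin.sum_univ_castSucc]
      simp [hsum]
    refine ⟨Fin.snoc v e, ?_, ?_, hs⟩
    · intro i
      induction i using Fin.lastCases with
      | last => simpa using he
      | cast i => simpa [Fin.init] using hv i
    · rw [isMeander_succ_iff, hs, Fin.init_snoc]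
      exact ⟨hm, hr⟩

/-- The state of a Motzkin N-walk. -/
def walkState : {n : ℕ} → (Fin n → Finset ℤ) → ReachState
  | 0, _ => .even 0 0
  | n + 1, w => (walkState (Fin.init w)).step (w (Fin.last n))

theorem toSet_walkState : ∀ {n : ℕ} {w : Fin n → Finset ℤ}, w ∈ motzkinNWalks n →
    (walkState w).toSet = reachPlus w
  | 0, w, _ => by
    ext r
    simp only [walkState, ReachState.toSet, reachPlus, Set.mem_ofPred_eq]
    constructor
    · intro h
      exact ⟨Fin.elim0, fun i => i.elim0, fun j => by simp [Fin.partialSum], by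
        simp at h ⊢; omega⟩
    · rintro ⟨v, _, _, rfl⟩
      simp
  | n + 1, w, hw => by
    rw [motzkinNWalks, Fin.mem_piFinset_iff_last_init] at hw
    ext r
    rw [walkState, ReachState.mem_toSet_step hw.1, toSet_walkState hw.2, mem_reachPlus_succ_iff]

theorem sum_motzkinNWalks_succ {M : Type*} [AddCommMonoid M] (n : ℕ)
    (f : (Fin (n + 1) → Finset ℤ) → M) :
    ∑ w ∈ motzkinNWalks (n + 1), f w =
      ∑ w ∈ motzkinNWalks n, ∑ s ∈ motzkinNSteps, f (Fin.snoc w s) := by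
  rw [Finset.sum_sigma']
  refine Finset.sum_bij' (fun w _ => ⟨Fin.init w, w (Fin.last n)⟩)
    (fun q _ => Fin.snoc q.1 q.2) ?_ ?_ ?_ ?_ ?_
  · intro w hw
    rw [motzkinNWalks, Fin.mem_piFinset_iff_last_init] at hw
    exact Finset.mem_sigma.2 ⟨hw.2, hw.1⟩
  · rintro ⟨w, s⟩ h
    rw [motzkinNWalks, Fin.mem_piFinset_iff_last_init]
    simpa [motzkinNWalks, Fin.init_snoc, and_comm, Fin.init] using h
  · intro w _
    simp
  · rintro ⟨w, s⟩ _
    simp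
  · intro w _
    simp

/-! ### Reading extrema, types and excursions off the state. -/

section states
variable {n : ℕ} {w : Fin n → Finset ℤ}

theorem isNMeander_iff_nonempty : IsNMeander w ↔ (reachPlus w).Nonempty :=
  ⟨fun ⟨v, h, h'⟩ => ⟨_, v, h, h', rfl⟩, fun ⟨_, v, h, h', _⟩ => ⟨v, h, h'⟩⟩

theorem isNExcursion_iff_zero_mem : IsNExcursion w ↔ (0 : ℤ) ∈ reachPlus w :=
  exists_congr fun _ => Iff.rfl

theorem minPlus_maxPlus_of_even {m k : ℕ} (h : reachPlus w = (ReachState.even m k).toSet) :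
    minPlus w = m ∧ maxPlus w = m + 2 * k := by
  constructor
  · refine IsLeast.csInf_eq (s := reachPlus w) ?_
    rw [h]
    exact ⟨by simp [ReachState.toSet], fun r hr => hr.1⟩
  · refine IsGreatest.csSup_eq (s := reachPlus w) ?_
    rw [h]
    exact ⟨by simp [ReachState.toSet], fun r hr => hr.2.1⟩

theorem minPlus_maxPlus_of_full {m e : ℕ} (h : reachPlus w = (ReachState.full m e).toSet) :
    minPlus w = m ∧ maxPlus w = m + e + 1 := by
  constructor
  · refine IsLeast.csInf_eq (s := reachPlus w) ?_
    rw [h]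
    exact ⟨by simp [ReachState.toSet]; omega, fun r hr => hr.1⟩
  · refine IsGreatest.csSup_eq (s := reachPlus w) ?_
    rw [h]
    exact ⟨by simp [ReachState.toSet]; omega, fun r hr => hr.2⟩

theorem not_isNMeander_of_dead (h : reachPlus w = ReachState.dead.toSet) : ¬ IsNMeander w := by
  rw [isNMeander_iff_nonempty, h]
  simp [ReachState.toSet]

theorem isNMeander_of_even {m k : ℕ} (h : reachPlus w = (ReachState.even m k).toSet) :
    IsNMeander w := by
  rw [isNMeander_iff_nonempty, h]
  exact ⟨m, by simp [ReachState.toSet]⟩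

theorem isNMeander_of_full {m e : ℕ} (h : reachPlus w = (ReachState.full m e).toSet) :
    IsNMeander w := by
  rw [isNMeander_iff_nonempty, h]
  exact ⟨m, by simp [ReachState.toSet]; omega⟩

theorem isNMeanderType1_of_even {m k : ℕ} (h : reachPlus w = (ReachState.even m k).toSet) :
    IsNMeanderType1 w := by
  refine ⟨isNMeander_of_even h, ?_⟩
  rw [(minPlus_maxPlus_of_even h).1, (minPlus_maxPlus_of_even h).2, h]
  rfl

theorem not_isNMeanderType2_of_even {m k : ℕ} (h : reachPlus w = (ReachState.even m k).toSet) :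
    ¬ IsNMeanderType2 w := by
  rintro ⟨-, h', h1⟩
  rw [(minPlus_maxPlus_of_even h).1, (minPlus_maxPlus_of_even h).2] at h' h1
  -- The point m + 1 tells the types apart: it lies in an interval of length at least 1 but has the
  -- wrong parity for `even m k`. Singletons are thus of type 1 only.
  have : (m + 1 : ℤ) ∈ reachPlus w := by
    rw [h']
    exact ⟨by omega, by omega⟩
  rw [h] at this
  have := this.2.2
  omega

theorem isNMeanderType2_of_full {m e : ℕ} (h : reachPlus w = (ReachState.full m e).toSet) :
    IsNMeanderType2 w := by
  refine ⟨isNMeander_of_full h, ?_, ?_⟩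
  · rw [(minPlus_maxPlus_of_full h).1, (minPlus_maxPlus_of_full h).2, h]
    rfl
  · rw [(minPlus_maxPlus_of_full h).1, (minPlus_maxPlus_of_full h).2]
    omega

theorem not_isNMeanderType1_of_full {m e : ℕ} (h : reachPlus w = (ReachState.full m e).toSet) :
    ¬ IsNMeanderType1 w := by
  rintro ⟨-, h'⟩
  rw [(minPlus_maxPlus_of_full h).1, (minPlus_maxPlus_of_full h).2, h] at h'
  have : (m + 1 : ℤ) ∈ (ReachState.full m e).toSet := ⟨by omega, by omega⟩
  rw [h'] at this
  have := this.2.2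
  omega

theorem isNExcursion_of_even_iff {m k : ℕ} (h : reachPlus w = (ReachState.even m k).toSet) :
    IsNExcursion w ↔ m = 0 := by
  rw [isNExcursion_iff_zero_mem, h]
  simp only [ReachState.toSet, Set.mem_ofPred_eq]
  omega

theorem isNExcursion_of_full_iff {m e : ℕ} (h : reachPlus w = (ReachState.full m e).toSet) :
    IsNExcursion w ↔ m = 0 := by
  rw [isNExcursion_iff_zero_mem, h]
  simp only [ReachState.toSet, Set.mem_ofPred_eq]
  omega

theorem not_isNExcursion_of_dead (h : reachPlus w = ReachState.dead.toSet) :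
    ¬ IsNExcursion w := by
  rw [isNExcursion_iff_zero_mem, h]
  simp [ReachState.toSet]

end states

end NWalk

/-! ### The Jacobian criterion for algebraicity. -/

section JacobianCriterion

/-- The chain rule: a polynomial relation among the u j becomes a linear relation among the D (u j).
-/
theorem MvPolynomial.derivation_aeval {ι k A M : Type*} [Fintype ι] [CommRing k] [CommRing A]
    [Algebra k A] [AddCommGroup M] [Module k M] [Module A M] [IsScalarTower k A M]
    (D : Derivation k A M) (u : ι → A) (Q : MvPolynomial ι k) :
    D (aeval u Q) = ∑ j, aeval u (pderiv j Q) • D (u j) := by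
  classical
  induction Q using MvPolynomial.induction_on with
  | C a => simp
  | add p q hp hq => simp [hp, hq, add_smul, Finset.sum_add_distrib]
  | mul_X p i hp =>
    simp only [map_mul, aeval_X, Derivation.leibniz, hp, map_add, add_smul, smul_eq_mul,
      Finset.sum_add_distrib, pderiv_X, Finset.smul_sum, mul_smul]
    congr 1
    rw [Finset.sum_eq_single i]
    · simp
    · intro j _ hj
      simp [Pi.single_eq_of_ne' hj]
    · simp

/-- Cramer's rule with unknowns in a module: the adjugate turns the system into det J • x i = 0. -/
theorem Matrix.eq_zero_of_sum_smul_eq_zero {ι A M : Type*} [Fintype ι] [DecidableEq ι] [Field A]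
    [AddCommGroup M] [Module A M] {J : Matrix ι ι A} (hJ : J.det ≠ 0) {x : ι → M}
    (h : ∀ i, ∑ j, J i j • x j = 0) (i : ι) : x i = 0 := by
  have h1 : ∑ l, J.adjugate i l • ∑ j, J l j • x j = 0 := by simp [h]
  simp only [Finset.smul_sum, smul_smul] at h1
  rw [Finset.sum_comm] at h1
  simp only [← Finset.sum_smul, ← Matrix.mul_apply, Matrix.adjugate_mul] at h1
  simpa [Matrix.smul_apply, Matrix.one_apply, hJ] using h1

/-- The Jacobian criterion over fields. -/
theorem isAlgebraic_of_jacobian_det_ne_zero_field {ι k F : Type*} [Fintype ι] [DecidableEq ι]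
    [Field k] [Field F] [Algebra k F] (v : ι → F) (P : ι → MvPolynomial ι k)
    (hP : ∀ i, MvPolynomial.aeval v (P i) = 0)
    (hdet : (Matrix.of fun i j => MvPolynomial.aeval v (MvPolynomial.pderiv j (P i))).det ≠ 0)
    (i : ι) : IsAlgebraic k (v i) := by
  classical
  -- In the finitely generated field k(v), differentials that vanish on the generators vanish
  -- everywhere.
  let L := IntermediateField.adjoin k (Set.range v)
  let u : ι → L := fun i => ⟨v i, IntermediateField.subset_adjoin _ _ ⟨i, rfl⟩⟩
  have hval (Q : MvPolynomial ι k) :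
      algebraMap L F (MvPolynomial.aeval u Q) = MvPolynomial.aeval v Q :=
    MvPolynomial.comp_aeval_apply u L.val Q
  have hDu : ∀ j, KaehlerDifferential.D k L (u j) = 0 := by
    refine Matrix.eq_zero_of_sum_smul_eq_zero
      (J := Matrix.of fun i j => MvPolynomial.aeval u (MvPolynomial.pderiv j (P i))) ?_ ?_
    · intro h0
      apply hdet
      have := congrArg (algebraMap L F) h0
      rw [RingHom.map_det, map_zero] at this
      rw [← this]
      congr 1
      ext i j
      simp [hval]
    · intro i
      simp only [Matrix.of_apply]
      rw [← MvPolynomial.derivation_aeval]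
      have : MvPolynomial.aeval u (P i) = 0 := by
        apply (algebraMap L F).injective
        rw [hval, hP, map_zero]
      rw [this, map_zero]
  have hD : ∀ x : L, KaehlerDifferential.D k L x = 0 := by
    rintro ⟨x, hx⟩
    induction hx using IntermediateField.adjoin_induction with
    | mem x hx =>
      obtain ⟨j, rfl⟩ := hx
      exact hDu j
    | algebraMap c => exact (KaehlerDifferential.D k L).map_algebraMap c
    | add x y hx hy h1 h2 =>
      have := (KaehlerDifferential.D k L).map_add (⟨x, hx⟩ : L) ⟨y, hy⟩
      rw [h1, h2, add_zero] at this
      exact this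
    | inv x hx h1 =>
      have := (KaehlerDifferential.D k L).leibniz_inv (⟨x, hx⟩ : L)
      rw [h1, smul_zero] at this
      exact this
    | mul x y hx hy h1 h2 =>
      have := (KaehlerDifferential.D k L).leibniz (⟨x, hx⟩ : L) ⟨y, hy⟩
      rw [h1, h2, smul_zero, smul_zero, add_zero] at this
      exact this
  -- Zero differentials and essentially finite type make L/k separable, hence algebraic.
  have : Algebra.FormallyUnramified k L := by
    rw [Algebra.formallyUnramified_iff, ← Submodule.subsingleton_iff L,
      ← subsingleton_iff_bot_eq_top, ← KaehlerDifferential.span_range_derivation, eq_comm,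
      Submodule.span_eq_bot]
    rintro _ ⟨x, rfl⟩
    exact hD x
  have : Algebra.EssFiniteType k L := by
    rw [IntermediateField.essFiniteType_iff]
    exact IntermediateField.fg_adjoin_of_finite (Set.finite_range v)
  have := Algebra.FormallyUnramified.isSeparable k L
  exact (Algebra.IsAlgebraic.isAlgebraic (R := k) (u i)).algebraMap (A := F)

/-- The Jacobian criterion over integral domains. -/
theorem isAlgebraic_of_jacobian_det_ne_zero {ι S B : Type*} [Fintype ι] [DecidableEq ι]
    [CommRing S] [IsDomain S] [CommRing B] [IsDomain B] [Algebra S B] [FaithfulSMul S B]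
    (v : ι → B) (P : ι → MvPolynomial ι S)
    (hP : ∀ i, MvPolynomial.aeval v (P i) = 0)
    (hdet : (Matrix.of fun i j => MvPolynomial.aeval v (MvPolynomial.pderiv j (P i))).det ≠ 0)
    (i : ι) : IsAlgebraic S (v i) := by
  let k := FractionRing S
  let F := FractionRing B
  let : Algebra k F := FractionRing.liftAlgebra S F
  have hval (Q : MvPolynomial ι S) : MvPolynomial.aeval (fun i => algebraMap B F (v i))
      (Q.map (algebraMap S k)) = algebraMap B F (MvPolynomial.aeval v Q) := by
    rw [MvPolynomial.aeval_map_algebraMap]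
    exact MvPolynomial.aeval_algebraMap_apply (B := F) v Q
  have key : IsAlgebraic k (algebraMap B F (v i)) := by
    refine isAlgebraic_of_jacobian_det_ne_zero_field (fun i => algebraMap B F (v i))
      (fun i => (P i).map (algebraMap S k)) (fun i => by rw [hval, hP, map_zero]) ?_ i
    simp only [MvPolynomial.pderiv_map, hval]
    intro h0
    apply hdet
    apply IsFractionRing.injective B F
    rw [RingHom.map_det, map_zero, ← h0]
    rfl
  rw [← IsFractionRing.isAlgebraic_iff S k F] at key
  exact (isAlgebraic_algebraMap_iff (IsFractionRing.injective B F)).1 key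

end JacobianCriterion

/-! ### Algebraic power series solutions of polynomial systems. -/

namespace PowerSeries

/-- A contracting map on tuples of power series has a fixed point. -/
theorem exists_fixed_point {ι R : Type*} [CommRing R] (f : (ι → R⟦X⟧) → ι → R⟦X⟧)
    (hf : ∀ (k : ℕ) (a b : ι → R⟦X⟧), (∀ i, (X : R⟦X⟧) ^ k ∣ a i - b i) →
      ∀ i, (X : R⟦X⟧) ^ (k + 1) ∣ f a i - f b i) :
    ∃ v, f v = v := by
  let s : ℕ → ι → R⟦X⟧ := fun n => f^[n] 0
  have hs : ∀ n, s (n + 1) = f (s n) := fun n => Function.iterate_succ_apply' f n 0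
  have h1 : ∀ n i, (X : R⟦X⟧) ^ n ∣ s (n + 1) i - s n i := by
    intro n
    induction n with
    | zero => simp
    | succ n ih =>
      rw [hs (n + 1)]
      nth_rw 2 [hs n]
      exact hf n _ _ ih
  have h2 : ∀ n d i, (X : R⟦X⟧) ^ n ∣ s (n + d) i - s n i := by
    intro n d i
    induction d with
    | zero => simp
    | succ d ih =>
      have := (pow_dvd_pow X (Nat.le_add_right n d)).trans (h1 (n + d) i)
      simpa [add_assoc] using dvd_add this ih
  -- By `h2`, coefficient n no longer changes from iterate n + 1 on.
  let v : ι → R⟦X⟧ := fun i => mk fun n => coeff n (s (n + 1) i)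
  have h3 : ∀ n i, (X : R⟦X⟧) ^ n ∣ v i - s n i := by
    intro n i
    rw [X_pow_dvd_iff]
    intro m hm
    obtain ⟨d, rfl⟩ := Nat.exists_eq_add_of_lt hm
    have := X_pow_dvd_iff.1 (h2 (m + 1) d i) m (Nat.lt_succ_self m)
    rw [map_sub, sub_eq_zero] at this
    rw [map_sub, coeff_mk, ← this, Nat.add_right_comm, sub_self]
  refine ⟨v, funext fun i => sub_eq_zero.1 (PowerSeries.ext fun n => ?_)⟩
  have h4 : (X : R⟦X⟧) ^ (n + 1) ∣ f v i - v i := by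
    have := dvd_sub (hf n _ _ (h3 n) i) (hs n ▸ h3 (n + 1) i)
    simpa using this
  simpa using X_pow_dvd_iff.1 h4 n (Nat.lt_succ_self n)

theorem algebraMap_polynomial {R : Type*} [CommRing R] (Q : Polynomial R) :
    algebraMap (Polynomial R) R⟦X⟧ Q = (Q : R⟦X⟧) := by
  rw [PowerSeries.algebraMap_apply']
  simp

/-- A system `v i = X * P i (v)` of polynomial equations with polynomial coefficients has a
solution in power series, and its components are algebraic. -/
theorem exists_isAlgebraic_solution {ι R : Type*} [Fintype ι] [CommRing R] [IsDomain R]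
    (P : ι → MvPolynomial ι (Polynomial R)) :
    ∃ v : ι → R⟦X⟧, ∀ i, v i = X * MvPolynomial.aeval v (P i) ∧ IsAlgebraic (Polynomial R) (v i) := by
  classical
  obtain ⟨v, hv⟩ := exists_fixed_point (fun v i => (X : R⟦X⟧) * MvPolynomial.aeval v (P i)) (by
    intro k a b hab i
    rw [pow_succ', ← mul_sub]
    refine mul_dvd_mul_left _ ?_
    -- Polynomials preserve congruence modulo X ^ k; the outer factor X supplies the extra order.
    let q := Ideal.Quotient.mkₐ (Polynomial R) (Ideal.span {(X : R⟦X⟧) ^ k})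
    have : q (MvPolynomial.aeval a (P i)) = q (MvPolynomial.aeval b (P i)) := by
      rw [MvPolynomial.comp_aeval_apply, MvPolynomial.comp_aeval_apply]
      congr 2
      funext j
      exact Ideal.Quotient.eq.2 (Ideal.mem_span_singleton.2 (hab j))
    exact Ideal.mem_span_singleton.1 (Ideal.Quotient.eq.1 this))
  have hv' : ∀ i, v i = X * MvPolynomial.aeval v (P i) := fun i => (congrFun hv i).symm
  refine ⟨v, fun i => ⟨hv' i, ?_⟩⟩
  have : FaithfulSMul (Polynomial R) R⟦X⟧ := by
    rw [faithfulSMul_iff_algebraMap_injective]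
    intro p q h
    rw [algebraMap_polynomial, algebraMap_polynomial] at h
    exact Polynomial.coe_injective R h
  refine isAlgebraic_of_jacobian_det_ne_zero v
    (fun i => MvPolynomial.X i - MvPolynomial.C Polynomial.X * P i) ?_ ?_ i
  · intro i
    simp only [map_sub, map_mul, MvPolynomial.aeval_X, MvPolynomial.aeval_C, algebraMap_polynomial,
      Polynomial.coe_X]
    rw [← hv' i, sub_self]
  · intro h0
    -- Modulo X the Jacobian of v i - X * P i is the identity matrix, so its determinant has
    -- constant coefficient 1.
    have := congrArg (constantCoeff (R := R)) h0
    rw [RingHom.map_det, map_zero] at this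
    refine one_ne_zero (α := R) ?_
    rw [← this, ← Matrix.det_one (n := ι)]
    congr 1
    ext i j
    simp [MvPolynomial.pderiv_X, algebraMap_polynomial, Matrix.one_apply, Pi.single_apply,
      eq_comm, apply_ite]

end PowerSeries

/-! ### Weighted sums over states and their functional equations. -/

noncomputable section

namespace PowerSeries

variable {R : Type*} [CommRing R]

theorem eq_of_forall_X_pow_dvd_sub {a b : R⟦X⟧} (h : ∀ n, (X : R⟦X⟧) ^ n ∣ a - b) : a = b :=
  PowerSeries.ext fun n => by
    simpa [sub_eq_zero] using X_pow_dvd_iff.1 (h (n + 1)) n (Nat.lt_succ_self n)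

/-- The sum `∑ X ^ n * c n` of a sequence `c` of power series. -/
def sumXPow (c : ℕ → R⟦X⟧) : R⟦X⟧ :=
  mk fun n => coeff n (∑ i ∈ Finset.range (n + 1), X ^ i * c i)

theorem X_pow_dvd_sumXPow_sub (c : ℕ → R⟦X⟧) (n : ℕ) :
    (X : R⟦X⟧) ^ n ∣ sumXPow c - ∑ i ∈ Finset.range n, X ^ i * c i := by
  rw [X_pow_dvd_iff]
  intro m hm
  obtain ⟨d, rfl⟩ := Nat.exists_eq_add_of_le (Nat.succ_le_of_lt hm)
  rw [map_sub, sumXPow, coeff_mk, Finset.sum_range_add _ (m + 1), map_add, sub_add_cancel_left,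
    neg_eq_zero]
  refine X_pow_dvd_iff.1 (Finset.dvd_sum fun i _ => ?_) m (Nat.lt_succ_self m)
  exact Dvd.dvd.mul_right (pow_dvd_pow _ (Nat.le_add_right _ _)) _

theorem sumXPow_eq (c : ℕ → R⟦X⟧) : sumXPow c = c 0 + X * sumXPow fun n => c (n + 1) := by
  refine eq_of_forall_X_pow_dvd_sub fun n => ?_
  have h1 := (pow_dvd_pow (X : R⟦X⟧) n.le_succ).trans (X_pow_dvd_sumXPow_sub c (n + 1))
  have h2 := Dvd.dvd.mul_left (X_pow_dvd_sumXPow_sub (fun n => c (n + 1)) n) (X : R⟦X⟧)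
  convert dvd_sub h1 h2 using 1
  rw [Finset.sum_range_succ', mul_sub, Finset.mul_sum]
  simp only [pow_succ', mul_assoc]
  ring

theorem sumXPow_add (c d : ℕ → R⟦X⟧) : sumXPow (c + d) = sumXPow c + sumXPow d := by
  refine eq_of_forall_X_pow_dvd_sub fun n => ?_
  convert dvd_sub (X_pow_dvd_sumXPow_sub (c + d) n)
    (dvd_add (X_pow_dvd_sumXPow_sub c n) (X_pow_dvd_sumXPow_sub d n)) using 1
  simp only [Pi.add_apply, mul_add, Finset.sum_add_distrib]
  ring

theorem sumXPow_smul (b : R⟦X⟧) (c : ℕ → R⟦X⟧) : sumXPow (b • c) = b * sumXPow c := by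
  refine eq_of_forall_X_pow_dvd_sub fun n => ?_
  convert dvd_sub (X_pow_dvd_sumXPow_sub (b • c) n)
    (Dvd.dvd.mul_left (X_pow_dvd_sumXPow_sub c n) b) using 1
  simp only [Pi.smul_apply, smul_eq_mul, mul_left_comm _ b, ← Finset.mul_sum]
  ring

theorem sumXPow_C (c : ℕ → R) : sumXPow (fun n => C (c n)) = mk c := by
  ext n
  rw [sumXPow, coeff_mk, coeff_mk, Finset.sum_range_succ, map_add, map_sum,
    Finset.sum_eq_zero, zero_add, mul_comm, coeff_C_mul_X_pow, if_pos rfl]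
  intro i hi
  rw [mul_comm, coeff_C_mul_X_pow, if_neg (Finset.mem_range.1 hi).ne']

end PowerSeries

namespace NWalk

open PowerSeries ReachState

section StateSum

variable {R : Type*} [CommRing R] (q : Finset ℤ → R)

/-- The sum of `φ (walkState w)` over all Motzkin N-walks `w`, weighted by the product of the
weights of the N-steps and by `X ^ n`, where `n` is the length. -/
def stateSum : (ReachState → R⟦X⟧) →ₗ[R⟦X⟧] R⟦X⟧ where
  toFun φ := sumXPow fun n => ∑ w ∈ motzkinNWalks n, C (∏ i, q (w i)) * φ (walkState w)
  map_add' φ ψ := by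
    rw [← sumXPow_add]
    simp only [Pi.add_apply, mul_add, Finset.sum_add_distrib]
    rfl
  map_smul' b φ := by
    rw [RingHom.id_apply, smul_eq_mul, ← sumXPow_smul]
    simp only [Pi.smul_apply, smul_eq_mul, mul_left_comm _ b, ← Finset.mul_sum]
    rfl

/-- The weighted sum of a function over the states reached by one more N-step. -/
def stepSum (φ : ReachState → R⟦X⟧) (σ : ReachState) : R⟦X⟧ :=
  ∑ s ∈ motzkinNSteps, C (q s) * φ (σ.step s)

/-- Obtained by separating the empty walk and removing the last step of every other walk. -/
theorem stateSum_eq (φ : ReachState → R⟦X⟧) :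
    stateSum q φ = φ (even 0 0) + X * stateSum q (stepSum q φ) := by
  change sumXPow _ = _ + X * sumXPow _
  rw [sumXPow_eq]
  congr 1
  · simp [motzkinNWalks, walkState]
  · congr 2
    funext n
    rw [sum_motzkinNWalks_succ]
    refine Finset.sum_congr rfl fun w _ => ?_
    rw [stepSum, Finset.mul_sum]
    refine Finset.sum_congr rfl fun s _ => ?_
    rw [walkState, Fin.init_snoc, Fin.snoc_last, Fin.prod_univ_castSucc, map_mul, mul_assoc]
    simp

theorem stateSum_C (φ : ReachState → R) : stateSum q (fun σ => C (φ σ)) =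
    mk fun n => ∑ w ∈ motzkinNWalks n, (∏ i, q (w i)) * φ (walkState w) := by
  rw [← sumXPow_C]
  change sumXPow _ = _
  simp only [map_sum, map_mul]

/-- The indicator function of `even 0 0`. -/
def evenOrigin : ReachState → R⟦X⟧
  | even 0 0 => 1
  | _ => 0

/-- The states `even 0 (k + 1)`, marked by `u ^ k`. -/
def evenAxis (u : R⟦X⟧) : ReachState → R⟦X⟧
  | even 0 (k + 1) => u ^ k
  | _ => 0

/-- The states `even (m + 1) k`, marked by `z ^ m * u ^ k`. -/
def evenInterior (z u : R⟦X⟧) : ReachState → R⟦X⟧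
  | even (m + 1) k => z ^ m * u ^ k
  | _ => 0

/-- The indicator function of `full 0 0`. -/
def fullOrigin : ReachState → R⟦X⟧
  | full 0 0 => 1
  | _ => 0

/-- The states `full 0 (e + 1)`, marked by `y ^ e`. -/
def fullAxis (y : R⟦X⟧) : ReachState → R⟦X⟧
  | full 0 (e + 1) => y ^ e
  | _ => 0

/-- The states `full (m + 1) e`, marked by `z ^ m * y ^ e`. -/
def fullInterior (z y : R⟦X⟧) : ReachState → R⟦X⟧
  | full (m + 1) e => z ^ m * y ^ e
  | _ => 0

/-- The states `even m k`, marked by `z ^ m * u ^ k`. -/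
def evenAll (z u : R⟦X⟧) : ReachState → R⟦X⟧
  | even m k => z ^ m * u ^ k
  | _ => 0

/-- The states `even 0 k`, marked by `u ^ k`. -/
def evenBoundary (u : R⟦X⟧) : ReachState → R⟦X⟧
  | even 0 k => u ^ k
  | _ => 0

/-- The states `full m e`, marked by `z ^ m * y ^ e`. -/
def fullAll (z y : R⟦X⟧) : ReachState → R⟦X⟧
  | full m e => z ^ m * y ^ e
  | _ => 0

/-- The states `full 0 e`, marked by `y ^ e`. -/
def fullBoundary (y : R⟦X⟧) : ReachState → R⟦X⟧
  | full 0 e => y ^ e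
  | _ => 0

theorem evenBoundary_eq (u : R⟦X⟧) :
    (evenBoundary u : ReachState → R⟦X⟧) = evenOrigin + u • evenAxis u := by
  funext σ
  rcases σ with _ | ⟨_ | m, _ | k⟩ | ⟨_ | m, _ | e⟩ <;>
    simp [evenOrigin, evenAxis, evenBoundary, pow_succ']

theorem evenAll_eq (z u : R⟦X⟧) :
    (evenAll z u : ReachState → R⟦X⟧) = evenBoundary u + z • evenInterior z u := by
  funext σ
  rcases σ with _ | ⟨_ | m, k⟩ | ⟨_ | m, e⟩ <;>
    simp [evenAll, evenInterior, evenBoundary, pow_succ', mul_assoc]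

theorem fullBoundary_eq (y : R⟦X⟧) :
    (fullBoundary y : ReachState → R⟦X⟧) = fullOrigin + y • fullAxis y := by
  funext σ
  rcases σ with _ | ⟨_ | m, _ | k⟩ | ⟨_ | m, _ | e⟩ <;>
    simp [fullOrigin, fullAxis, fullBoundary, pow_succ']

theorem fullAll_eq (z y : R⟦X⟧) :
    (fullAll z y : ReachState → R⟦X⟧) = fullBoundary y + z • fullInterior z y := by
  funext σ
  rcases σ with _ | ⟨_ | m, k⟩ | ⟨_ | m, e⟩ <;>
    simp [fullAll, fullInterior, fullBoundary, pow_succ', mul_assoc]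

/-- The terms supported on minimum 0 come from the barrier. The `fullOrigin` term is the only return
from `full` to `even`: the step {-1} takes {0, 1} to {0}. -/
theorem stepSum_evenAll (z u : R⟦X⟧) :
    stepSum q (evenAll z u) =
      (C (q {-1}) + C (q {-1, 1}) * u) • evenInterior z u +
      (C (q {0}) + C (q {1}) * z) • evenAll z u +
      (C (q {-1, 1}) * z) • evenBoundary u +
      (C (q {-1}) * z) • evenAxis u + C (q {-1, 0}) • evenOrigin + C (q {-1}) • fullOrigin := by
  funext σ
  rcases σ with _ | ⟨_ | m, _ | k⟩ | ⟨_ | m, _ | e⟩ <;>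
    simp [stepSum, sum_motzkinNSteps, step, move, evenOrigin, evenAxis, evenInterior,
      fullOrigin, evenAll, evenBoundary] <;> ring

/-- Filling the gaps of a progression of length 2k gives an interval of comparable length, so the
even series enter with u = y². -/
theorem stepSum_fullAll (z y : R⟦X⟧) :
    stepSum q (fullAll z y) =
      (C (q {-1}) + C (q {-1, 0}) * y + (C (q {-1, 1}) + C (q {-1, 0, 1})) * y ^ 2) •
        fullInterior z y +
      (C (q {0}) + C (q {1}) * z + C (q {0, 1}) * y) • fullAll z y +
      (C (q {-1, 0}) + (C (q {-1, 1}) + C (q {-1, 0, 1})) * y) • fullBoundary y +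
      C (q {-1}) • fullAxis y +
      (C (q {-1, 0}) + C (q {-1, 0, 1}) * y + C (q {0, 1}) * z) • evenInterior z (y ^ 2) +
      (C (q {-1, 0}) * y) • evenAxis (y ^ 2) +
      (C (q {0, 1}) + C (q {-1, 0, 1})) • evenBoundary (y ^ 2) := by
  funext σ
  rcases σ with _ | ⟨_ | m, _ | k⟩ | ⟨_ | m, _ | e⟩ <;>
    simp [stepSum, sum_motzkinNSteps, step, move, evenAxis, evenInterior, fullAxis,
      fullInterior, evenBoundary, fullAll, fullBoundary] <;> ring

theorem stateSum_evenAll (z u : R⟦X⟧) :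
    stateSum q (evenAll z u) = 1 + X * (
      (C (q {-1}) + C (q {-1, 1}) * u) * stateSum q (evenInterior z u) +
      (C (q {0}) + C (q {1}) * z) * stateSum q (evenAll z u) +
      C (q {-1, 1}) * z * stateSum q (evenBoundary u) +
      C (q {-1}) * z * stateSum q (evenAxis u) + C (q {-1, 0}) * stateSum q evenOrigin +
      C (q {-1}) * stateSum q fullOrigin) := by
  conv_lhs => rw [stateSum_eq, stepSum_evenAll]
  simp [evenAll]

theorem stateSum_fullAll (z y : R⟦X⟧) :
    stateSum q (fullAll z y) = X * (
      (C (q {-1}) + C (q {-1, 0}) * y + (C (q {-1, 1}) + C (q {-1, 0, 1})) * y ^ 2) *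
        stateSum q (fullInterior z y) +
      (C (q {0}) + C (q {1}) * z + C (q {0, 1}) * y) * stateSum q (fullAll z y) +
      (C (q {-1, 0}) + (C (q {-1, 1}) + C (q {-1, 0, 1})) * y) * stateSum q (fullBoundary y) +
      C (q {-1}) * stateSum q (fullAxis y) +
      (C (q {-1, 0}) + C (q {-1, 0, 1}) * y + C (q {0, 1}) * z) *
        stateSum q (evenInterior z (y ^ 2)) +
      C (q {-1, 0}) * y * stateSum q (evenAxis (y ^ 2)) +
      (C (q {0, 1}) + C (q {-1, 0, 1})) * stateSum q (evenBoundary (y ^ 2))) := by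
  conv_lhs => rw [stateSum_eq, stepSum_fullAll]
  simp [fullAll]

end StateSum

end NWalk

/-! ### Elimination by the kernel method. -/

namespace NWalk

/-- Elimination of the catalytic variables from the functional equations of the even and full
states: the equations `e1`, `e2`, `e3` are those of the even states at `(V, U)`, `(Z, Y ^ 2)` and
`(W, Y ^ 2)`, the equation `f` is that of the full states at `(Z, Y)`. -/
theorem mem_of_kernel_equations {B : Type*} [CommRing B] [IsDomain B] (A : Subring B)
    (hA : ∀ c v : B, c ≠ 0 → c ∈ A → c * v ∈ A → v ∈ A)
    {t α β γ δ ε ζ η U V Y Z W a b aU nU aY nZ nW bY mZ : B}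
    (ht : t ≠ 0) (ht1 : ∀ s, 1 - t * s ≠ 0) (ht2 : ∀ s, 2 - t * s ≠ 0)
    (mt : t ∈ A) (mα : α ∈ A) (mβ : β ∈ A) (mγ : γ ∈ A) (mδ : δ ∈ A) (mε : ε ∈ A) (mζ : ζ ∈ A)
    (mη : η ∈ A) (mV : V ∈ A) (mY : Y ∈ A) (mZA : Z ∈ A) (mW : W ∈ A)
    (hU : U = t * (α * V + U * (β + (γ + ζ) * V)))
    (hV : V = t * (α + ζ * U + β * V + γ * V ^ 2))
    (hY : Y = t * (α + Y * (β + δ + γ * Z + (ε + ζ + η) * Y)))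
    (hZ : Z = t * (α + δ * Y + (ζ + η) * Y ^ 2 + (β + ε * Y) * Z + γ * Z ^ 2))
    (hW : W = t * (α + ζ * Y ^ 2 + β * W + γ * W ^ 2))
    (e1 : a + U * aU + V * nU = 1 + t * ((α + ζ * U) * nU + (β + γ * V) * (a + U * aU + V * nU) +
      ζ * V * (a + U * aU) + α * V * aU + δ * a + α * b))
    (e2 : a + Y ^ 2 * aY + Z * nZ = 1 + t * ((α + ζ * Y ^ 2) * nZ +
      (β + γ * Z) * (a + Y ^ 2 * aY + Z * nZ) +
      ζ * Z * (a + Y ^ 2 * aY) + α * Z * aY + δ * a + α * b))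
    (e3 : a + Y ^ 2 * aY + W * nW = 1 + t * ((α + ζ * Y ^ 2) * nW +
      (β + γ * W) * (a + Y ^ 2 * aY + W * nW) +
      ζ * W * (a + Y ^ 2 * aY) + α * W * aY + δ * a + α * b))
    (f : b + Y * bY + Z * mZ = t * ((α + δ * Y + (ζ + η) * Y ^ 2) * mZ +
      (β + γ * Z + ε * Y) * (b + Y * bY + Z * mZ) + (δ + (ζ + η) * Y) * (b + Y * bY) + α * bY +
      (δ + η * Y + ε * Z) * nZ + δ * Y * aY + (ε + η) * (a + Y ^ 2 * aY))) :
    a ∈ A := by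
  -- `hV` and `hU` annihilate the coefficients of nU and aU in `e1`.
  have r1 : a * (1 - t * (β + δ + (γ + ζ) * V)) = 1 + t * α * b := by
    linear_combination e1 - nU * hV - aU * hU
  -- In `e2` + Y · `f` the coefficient of nZ is the same kernel as that of mZ in `f`, so `hZ`
  -- removes both; `hY` removes bY and makes the terms in b cancel.
  have r2 : 1 - a * (1 - t * (β + δ + γ * Z + (ε + ζ + η) * Y) + t * ζ * (Y - Z)) =
      t * (Y - Z) * (α + ζ * Y ^ 2) * aY := by
    linear_combination -e2 - Y * f + (nZ + Y * mZ) * hZ + (b + Y * bY + Y * aY) * hY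
  -- κ is the coefficient of aY in `e3` once `hW` has removed nW.
  set κ := Y ^ 2 * (1 - t * (β + (γ + ζ) * W)) - t * α * W with hκ
  have r3 : κ * aY = 1 + t * (δ * a + α * b) - a * (1 - t * (β + (γ + ζ) * W)) := by
    linear_combination e3 - nW * hW
  -- Here `r3` eliminates aY and `r1` eliminates b. If κ ≠ 0, the factor of a cannot vanish, since
  -- its product with a is κ.
  have r4 : (κ * (1 - t * (β + δ + γ * Z + (ε + ζ + η) * Y) + t * ζ * (Y - Z)) +
      t ^ 2 * (Y - Z) * (α + ζ * Y ^ 2) * (γ + ζ) * (W - V)) * a = κ := by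
    linear_combination -κ * r2 - t * (Y - Z) * (α + ζ * Y ^ 2) * (r3 - r1)
  by_cases hα : α = 0
  · refine hA (1 - t * (β + δ + (γ + ζ) * V)) a (ht1 _) ?_ ?_
    · repeat' first | exact one_mem _ | assumption | apply add_mem | apply sub_mem | apply mul_mem
    · rw [mul_comm, r1, hα]
      simp [one_mem]
  -- In the degenerate case κ = 0 the kernels force W = Y = Z and δ + (ε + η)Y = 0. Then `f` alone
  -- gives αb = -δa, and `r1` determines a.
  by_cases hk : κ = 0
  · have hY0 : Y ≠ 0 := by
      intro h
      rw [h] at hY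
      simp [ht, hα] at hY
    have h1 : (Y ^ 2 - W ^ 2) * (1 - t * (β + γ * W)) = 0 := by
      linear_combination hk - hκ - W * hW
    have h2 : (Y - W) * (Y + W) = 0 := by
      linear_combination (mul_eq_zero.1 h1).resolve_right (ht1 _)
    -- If W = -Y, subtracting `hW` from `hY` leaves Y(2 - t·s) = 0; this is where 2 ≠ 0 matters.
    have h3 : Y + W ≠ 0 := by
      intro h
      have hYW : W = -Y := by linear_combination h
      rw [hYW] at hW
      have : Y * (2 - t * (2 * β + δ + γ * Z + (ε + η) * Y - γ * Y)) = 0 := by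
        linear_combination hY - hW
      exact (mul_ne_zero hY0 (ht2 _)) this
    have h4 : W = Y := by linear_combination -(mul_eq_zero.1 h2).resolve_right h3
    rw [h4] at hW
    have h5 : δ + γ * (Z - Y) + (ε + η) * Y = 0 := by
      refine (mul_eq_zero.1 (?_ : (t * Y) * _ = 0)).resolve_left (mul_ne_zero ht hY0)
      linear_combination hW - hY
    have h6 : Z - Y = 0 := by
      refine (mul_eq_zero.1 (?_ : _ * (1 - t * (β + ε * Y + γ * Z)) = 0)).resolve_right (ht1 _)
      linear_combination hZ - hW + t * Y * h5
    have h7 : Z = Y := by linear_combination h6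
    rw [h7] at hY hZ f h5
    have h8 : α * b = -(δ * a) := by
      have : t * (α * b + δ * a) = 0 := by
        linear_combination Y * f - Y * mZ * hZ - (b + Y * bY) * hY +
          (t * Y * nZ + t * Y ^ 2 * aY + t * a) * h5
      linear_combination (mul_eq_zero.1 this).resolve_left ht
    refine hA (1 - t * (β + (γ + ζ) * V)) a (ht1 _) ?_ ?_
    · repeat' first | exact one_mem _ | assumption | apply add_mem | apply sub_mem | apply mul_mem
    · have : (1 - t * (β + (γ + ζ) * V)) * a = 1 := by
        linear_combination r1 + t * h8
      rw [this]
      exact one_mem _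
  · have mκ : κ ∈ A := by
      rw [hκ, pow_two]
      repeat' first | exact one_mem _ | assumption | apply add_mem | apply sub_mem | apply mul_mem
    refine hA _ a ?_ ?_ (Eq.mpr (congrArg (· ∈ A) r4) mκ)
    · intro h
      rw [h, zero_mul] at r4
      exact hk r4.symm
    · rw [pow_two, pow_two]
      repeat' first | exact one_mem _ | assumption | apply add_mem | apply sub_mem | apply mul_mem

/-- The functional equations of the even and full states determine their generating functions
algebraically, once the coefficients `a` and `α * b` are known: the equations `e1`, `e2`, `e3` are
those of the even states at `(V, y ^ 2)`, `(Z, y ^ 2)` and `(z, y ^ 2)`, the equations `f2` and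
`f3` are those of the full states at `(Z, y)` and `(z, y)`. -/
theorem mem_of_functional_equations {B : Type*} [CommRing B] (A : Subring B)
    (hA : ∀ c v : B, c ≠ 0 → c ∈ A → c * v ∈ A → v ∈ A)
    {t α β γ δ ε ζ η y z V Z a b aY nV nZ n bY mZ m : B}
    (hz1 : ∀ s, z - t * s ≠ 0) (hy1 : ∀ s, y - t * s ≠ 0) (hy2 : ∀ s, y ^ 2 - t * s ≠ 0)
    (mt : t ∈ A) (mα : α ∈ A) (mβ : β ∈ A) (mγ : γ ∈ A) (mδ : δ ∈ A) (mε : ε ∈ A) (mζ : ζ ∈ A)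
    (mη : η ∈ A) (my : y ∈ A) (mz : z ∈ A) (mV : V ∈ A) (mZA : Z ∈ A) (ma : a ∈ A)
    (mb : α * b ∈ A)
    (hV : V = t * (α + ζ * y ^ 2 + β * V + γ * V ^ 2))
    (hZ : Z = t * (α + δ * y + (ζ + η) * y ^ 2 + (β + ε * y) * Z + γ * Z ^ 2))
    (e1 : a + y ^ 2 * aY + V * nV = 1 + t * ((α + ζ * y ^ 2) * nV +
      (β + γ * V) * (a + y ^ 2 * aY + V * nV) +
      ζ * V * (a + y ^ 2 * aY) + α * V * aY + δ * a + α * b))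
    (e2 : a + y ^ 2 * aY + Z * nZ = 1 + t * ((α + ζ * y ^ 2) * nZ +
      (β + γ * Z) * (a + y ^ 2 * aY + Z * nZ) +
      ζ * Z * (a + y ^ 2 * aY) + α * Z * aY + δ * a + α * b))
    (e3 : a + y ^ 2 * aY + z * n = 1 + t * ((α + ζ * y ^ 2) * n +
      (β + γ * z) * (a + y ^ 2 * aY + z * n) +
      ζ * z * (a + y ^ 2 * aY) + α * z * aY + δ * a + α * b))
    (f2 : b + y * bY + Z * mZ = t * ((α + δ * y + (ζ + η) * y ^ 2) * mZ +
      (β + γ * Z + ε * y) * (b + y * bY + Z * mZ) + (δ + (ζ + η) * y) * (b + y * bY) + α * bY +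
      (δ + η * y + ε * Z) * nZ + δ * y * aY + (ε + η) * (a + y ^ 2 * aY)))
    (f3 : b + y * bY + z * m = t * ((α + δ * y + (ζ + η) * y ^ 2) * m +
      (β + γ * z + ε * y) * (b + y * bY + z * m) + (δ + (ζ + η) * y) * (b + y * bY) + α * bY +
      (δ + η * y + ε * z) * n + δ * y * aY + (ε + η) * (a + y ^ 2 * aY))) :
    a + y ^ 2 * aY ∈ A ∧ b + y * bY ∈ A ∧ a + y ^ 2 * aY + z * n ∈ A ∧
      b + y * bY + z * m ∈ A := by
  have my2 : y ^ 2 ∈ A := pow_mem my 2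
  have maY : aY ∈ A := by
    have h : (y ^ 2 - t * (y ^ 2 * (β + (γ + ζ) * V) + α * V)) * aY =
        1 + t * (δ * a + α * b) - a * (1 - t * (β + (γ + ζ) * V)) := by
      linear_combination e1 - nV * hV
    refine hA _ _ (hy2 _) ?_ (Eq.mpr (congrArg (· ∈ A) h) ?_)
    all_goals
      repeat' first | exact one_mem _ | assumption | apply add_mem | apply sub_mem | apply mul_mem
  -- As for `r2` above, `e2` + y · `f2` has a single kernel for nZ and mZ.
  have mbb : b + y * bY ∈ A := by
    have h : (y - t * (y * (β + δ + γ * Z + (ε + ζ + η) * y) + α)) * (b + y * bY) =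
        1 + t * ((β + (γ + ζ) * Z) * (a + y ^ 2 * aY) + α * Z * aY + δ * a + α * b) -
          (a + y ^ 2 * aY) + t * δ * y ^ 2 * aY + t * (ε + η) * y * (a + y ^ 2 * aY) -
          t * (α * b) := by
      linear_combination e2 + y * f2 - (nZ + y * mZ) * hZ
    refine hA _ _ (hy1 _) ?_ (Eq.mpr (congrArg (· ∈ A) h) ?_)
    all_goals
      repeat' first | exact one_mem _ | assumption | apply add_mem | apply sub_mem | apply mul_mem
  have mn : n ∈ A := by
    have h : (z - t * (α + ζ * y ^ 2 + (β + γ * z) * z)) * n =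
        1 + t * ((β + γ * z) * (a + y ^ 2 * aY) + ζ * z * (a + y ^ 2 * aY) + α * z * aY +
          δ * a + α * b) - (a + y ^ 2 * aY) := by
      linear_combination e3
    refine hA _ _ (hz1 _) ?_ (Eq.mpr (congrArg (· ∈ A) h) ?_)
    all_goals
      repeat' first | exact one_mem _ | assumption | apply add_mem | apply sub_mem | apply mul_mem
  -- Only αb is known, not b, so αbY is recovered in place of bY; this product is all that `f3`
  -- requires.
  have mbY : α * bY ∈ A := by
    have h : y * (α * bY) = α * (b + y * bY) - α * b := by ring
    refine hA _ _ (by simpa using hy1 0) my (Eq.mpr (congrArg (· ∈ A) h) ?_)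
    repeat' first | exact one_mem _ | assumption | apply add_mem | apply sub_mem | apply mul_mem
  have mm : m ∈ A := by
    have h : (z - t * (α + δ * y + (ζ + η) * y ^ 2 + (β + γ * z + ε * y) * z)) * m =
        t * ((β + γ * z + ε * y) * (b + y * bY) + (δ + (ζ + η) * y) * (b + y * bY) + α * bY +
      (δ + η * y + ε * z) * n + δ * y * aY + (ε + η) * (a + y ^ 2 * aY)) - (b + y * bY) := by
      linear_combination f3
    refine hA _ _ (hz1 _) ?_ (Eq.mpr (congrArg (· ∈ A) h) ?_)
    all_goals
      repeat' first | exact one_mem _ | assumption | apply add_mem | apply sub_mem | apply mul_mem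
  refine ⟨?_, mbb, ?_, add_mem mbb (mul_mem mz mm)⟩
  all_goals
    repeat' first | exact one_mem _ | assumption | apply add_mem | apply sub_mem | apply mul_mem

end NWalk
-- Algebraicity of the sums over states.
namespace NWalk

open PowerSeries ReachState

section Algebraicity

variable {R : Type*} [CommRing R] (q : Finset ℤ → R)

theorem C_sub_X_mul_ne_zero {r : R} (hr : r ≠ 0) (s : R⟦X⟧) : C r - X * s ≠ 0 := by
  intro h
  apply hr
  simpa using congrArg (constantCoeff (R := R)) h

theorem stateSum_evenAll_expand (z u : R⟦X⟧) :
    stateSum q evenOrigin + u * stateSum q (evenAxis u) + z * stateSum q (evenInterior z u) =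
    1 + X * ((C (q {-1}) + C (q {-1, 1}) * u) * stateSum q (evenInterior z u) +
      (C (q {0}) + C (q {1}) * z) * (stateSum q evenOrigin + u * stateSum q (evenAxis u) +
        z * stateSum q (evenInterior z u)) +
      C (q {-1, 1}) * z * (stateSum q evenOrigin + u * stateSum q (evenAxis u)) +
      C (q {-1}) * z * stateSum q (evenAxis u) + C (q {-1, 0}) * stateSum q evenOrigin +
      C (q {-1}) * stateSum q fullOrigin) := by
  simpa only [evenAll_eq, evenBoundary_eq, map_add, map_smul, smul_eq_mul] using
    stateSum_evenAll q z u

theorem stateSum_fullAll_expand (z y : R⟦X⟧) :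
    stateSum q fullOrigin + y * stateSum q (fullAxis y) + z * stateSum q (fullInterior z y) =
    X * ((C (q {-1}) + C (q {-1, 0}) * y + (C (q {-1, 1}) + C (q {-1, 0, 1})) * y ^ 2) *
        stateSum q (fullInterior z y) +
      (C (q {0}) + C (q {1}) * z + C (q {0, 1}) * y) * (stateSum q fullOrigin +
        y * stateSum q (fullAxis y) + z * stateSum q (fullInterior z y)) +
      (C (q {-1, 0}) + (C (q {-1, 1}) + C (q {-1, 0, 1})) * y) *
        (stateSum q fullOrigin + y * stateSum q (fullAxis y)) +
      C (q {-1}) * stateSum q (fullAxis y) +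
      (C (q {-1, 0}) + C (q {-1, 0, 1}) * y + C (q {0, 1}) * z) *
        stateSum q (evenInterior z (y ^ 2)) +
      C (q {-1, 0}) * y * stateSum q (evenAxis (y ^ 2)) +
      (C (q {0, 1}) + C (q {-1, 0, 1})) *
        (stateSum q evenOrigin + y ^ 2 * stateSum q (evenAxis (y ^ 2)))) := by
  simpa only [fullAll_eq, fullBoundary_eq, evenBoundary_eq, map_add, map_smul, smul_eq_mul] using
    stateSum_fullAll q z y

variable [IsDomain R]

variable (R) in
/-- The ring of algebraic power series. -/
def algebraicSeries : Subring R⟦X⟧ :=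
  (Subalgebra.algebraicClosure (Polynomial R) R⟦X⟧).toSubring

theorem mem_algebraicSeries {f : R⟦X⟧} :
    f ∈ algebraicSeries R ↔ IsAlgebraic (Polynomial R) f := Iff.rfl

theorem C_mem_algebraicSeries (r : R) : (C r : R⟦X⟧) ∈ algebraicSeries R := by
  rw [mem_algebraicSeries, ← Polynomial.coe_C, ← algebraMap_polynomial]
  exact isAlgebraic_algebraMap _

theorem X_mem_algebraicSeries : (X : R⟦X⟧) ∈ algebraicSeries R := by
  rw [mem_algebraicSeries, ← Polynomial.coe_X, ← algebraMap_polynomial]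
  exact isAlgebraic_algebraMap _

theorem mem_algebraicSeries_of_mul_mem (c v : R⟦X⟧) (hc : c ≠ 0) (h : c ∈ algebraicSeries R)
    (hcv : c * v ∈ algebraicSeries R) : v ∈ algebraicSeries R :=
  IsAlgebraic.of_mul (mem_nonZeroDivisors_of_ne_zero hc) h hcv

/-- The kernel relation `e1` contains the `fullOrigin` sum only multiplied by the weight of {-1},
which may be zero; hence the second claim concerns the product. -/
theorem stateSum_origin_mem (h2 : (2 : R) ≠ 0) :
    stateSum q evenOrigin ∈ algebraicSeries R ∧
      C (q {-1}) * stateSum q fullOrigin ∈ algebraicSeries R := by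
  let c : R → MvPolynomial (Fin 5) (Polynomial R) := fun r => MvPolynomial.C (Polynomial.C r)
  -- Components 0 to 4 are the kernel series U, V, Y, Z, W of `mem_of_kernel_equations`.
  obtain ⟨v, hv⟩ := exists_isAlgebraic_solution (R := R) (ι := Fin 5)
    ![c (q {-1}) * .X 1 + .X 0 * (c (q {0}) + (c (q {1}) + c (q {-1, 1})) * .X 1),
      c (q {-1}) + c (q {-1, 1}) * .X 0 + c (q {0}) * .X 1 + c (q {1}) * .X 1 ^ 2,
      c (q {-1}) + .X 2 * (c (q {0}) + c (q {-1, 0}) + c (q {1}) * .X 3 +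
        (c (q {0, 1}) + c (q {-1, 1}) + c (q {-1, 0, 1})) * .X 2),
      c (q {-1}) + c (q {-1, 0}) * .X 2 + (c (q {-1, 1}) + c (q {-1, 0, 1})) * .X 2 ^ 2 +
        (c (q {0}) + c (q {0, 1}) * .X 2) * .X 3 + c (q {1}) * .X 3 ^ 2,
      c (q {-1}) + c (q {-1, 1}) * .X 2 ^ 2 + c (q {0}) * .X 4 + c (q {1}) * .X 4 ^ 2]
  have hU := (hv 0).1
  have hV := (hv 1).1
  have hY := (hv 2).1
  have hZ := (hv 3).1
  have hW := (hv 4).1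
  simp [c, algebraMap_polynomial] at hU hV hY hZ hW
  have ma : stateSum q evenOrigin ∈ algebraicSeries R := by
    refine mem_of_kernel_equations (algebraicSeries R) mem_algebraicSeries_of_mul_mem X_ne_zero
      (fun s => by simpa using C_sub_X_mul_ne_zero (one_ne_zero (α := R)) s)
      (fun s => map_ofNat (C (R := R)) 2 ▸ C_sub_X_mul_ne_zero h2 s)
      X_mem_algebraicSeries (C_mem_algebraicSeries _) (C_mem_algebraicSeries _)
      (C_mem_algebraicSeries _) (C_mem_algebraicSeries _) (C_mem_algebraicSeries _)
      (C_mem_algebraicSeries _) (C_mem_algebraicSeries _)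
      (hv 1).2 (hv 2).2 (hv 3).2 (hv 4).2 hU hV hY hZ hW
      (stateSum_evenAll_expand q _ _) (stateSum_evenAll_expand q _ _)
      (stateSum_evenAll_expand q _ _) (stateSum_fullAll_expand q _ _)
  refine ⟨ma, ?_⟩
  have e1 := stateSum_evenAll_expand q (v 1) (v 0)
  have h : X * (C (q {-1}) * stateSum q fullOrigin) = stateSum q evenOrigin *
      (1 - X * (C (q {0}) + C (q {-1, 0}) + (C (q {1}) + C (q {-1, 1})) * v 1)) - 1 := by
    linear_combination -e1 + stateSum q (evenInterior (v 1) (v 0)) * hV +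
      stateSum q (evenAxis (v 0)) * hU
  refine mem_algebraicSeries_of_mul_mem _ _ X_ne_zero X_mem_algebraicSeries ?_
  rw [h]
  have mV : v 1 ∈ algebraicSeries R := (hv 1).2
  repeat' first
    | exact one_mem _ | exact C_mem_algebraicSeries _ | exact X_mem_algebraicSeries
    | assumption | apply add_mem | apply sub_mem | apply mul_mem

/-- The generating functions of the even and the full states, and of those with minimum `0`,
are algebraic. -/
theorem stateSum_mem (h2 : (2 : R) ≠ 0) {y z : R} (hy : y ≠ 0) (hz : z ≠ 0) :
    stateSum q (evenBoundary (C y ^ 2)) ∈ algebraicSeries R ∧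
    stateSum q (fullBoundary (C y)) ∈ algebraicSeries R ∧
    stateSum q (evenAll (C z) (C y ^ 2)) ∈ algebraicSeries R ∧
    stateSum q (fullAll (C z) (C y)) ∈ algebraicSeries R := by
  let c : R → MvPolynomial (Fin 2) (Polynomial R) := fun r => MvPolynomial.C (Polynomial.C r)
  -- Components 0 and 1 are V and Z of `mem_of_functional_equations`, for the constant series y.
  obtain ⟨v, hv⟩ := exists_isAlgebraic_solution (R := R) (ι := Fin 2)
    ![c (q {-1}) + c (q {-1, 1}) * c y ^ 2 + c (q {0}) * .X 0 + c (q {1}) * .X 0 ^ 2,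
      c (q {-1}) + c (q {-1, 0}) * c y + (c (q {-1, 1}) + c (q {-1, 0, 1})) * c y ^ 2 +
        (c (q {0}) + c (q {0, 1}) * c y) * .X 1 + c (q {1}) * .X 1 ^ 2]
  have hV := (hv 0).1
  have hZ := (hv 1).1
  simp [c, algebraMap_polynomial] at hV hZ
  simp only [fullAll_eq, fullBoundary_eq, evenAll_eq, evenBoundary_eq, map_add, map_smul,
    smul_eq_mul]
  exact mem_of_functional_equations (algebraicSeries R) mem_algebraicSeries_of_mul_mem
    (C_sub_X_mul_ne_zero hz) (C_sub_X_mul_ne_zero hy)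
    (fun s => by simpa using C_sub_X_mul_ne_zero (pow_ne_zero 2 hy) s)
    X_mem_algebraicSeries (C_mem_algebraicSeries _) (C_mem_algebraicSeries _)
    (C_mem_algebraicSeries _) (C_mem_algebraicSeries _) (C_mem_algebraicSeries _)
    (C_mem_algebraicSeries _) (C_mem_algebraicSeries _) (C_mem_algebraicSeries _)
    (C_mem_algebraicSeries _) (hv 0).2 (hv 1).2
    (stateSum_origin_mem q h2).1 (stateSum_origin_mem q h2).2 hV hZ
    (stateSum_evenAll_expand q _ _) (stateSum_evenAll_expand q _ _)
    (stateSum_evenAll_expand q _ _) (stateSum_fullAll_expand q _ _)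
    (stateSum_fullAll_expand q _ _)

end Algebraicity

end NWalk
-- The five generating functions as sums over states.
namespace NWalk

open PowerSeries ReachState

open Classical in
-- Reduces each series to a comparison of summands, one shape of state at a time.
theorem mk_sum_filter_eq_stateSum {R : Type*} [CommRing R] (q : Finset ℤ → R)
    (P : ∀ {n : ℕ}, (Fin n → Finset ℤ) → Prop)
    (f : ∀ {n : ℕ}, (Fin n → Finset ℤ) → R) (φ : ReachState → R)
    (h : ∀ {n : ℕ} (w : Fin n → Finset ℤ), reachPlus w = (walkState w).toSet →
      (if P w then f w else 0) = (∏ i, q (w i)) * φ (walkState w)) :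
    (PowerSeries.mk fun n => ∑ w ∈ motzkinNWalks n with P w, f w) =
      stateSum q fun σ => C (φ σ) := by
  rw [stateSum_C]
  congr 1
  funext n
  rw [Finset.sum_filter]
  exact Finset.sum_congr rfl fun w hw => h w (toSet_walkState hw).symm

section Series

variable {K : Type*} [Field K] (p : Finset ℤ → K)

theorem meanderSeries_eq :
    meanderSeries p = stateSum p (evenAll (C 1) (C 1 ^ 2)) + stateSum p (fullAll (C 1) (C 1)) := by
  rw [← map_add, meanderSeries, mk_sum_filter_eq_stateSum p IsNMeander (weight p)
    (fun σ => match σ with | dead => 0 | _ => 1)]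
  · congr 1
    funext σ
    rcases σ with _ | ⟨m, k⟩ | ⟨m, e⟩ <;> simp [evenAll, fullAll]
  · intro n w h
    generalize walkState w = σ at h
    rcases σ with _ | ⟨m, k⟩ | ⟨m, e⟩
    · simp [not_isNMeander_of_dead h]
    · simp [isNMeander_of_even h, weight]
    · simp [isNMeander_of_full h, weight]

theorem excursionSeries_eq :
    excursionSeries p = stateSum p (evenBoundary (C 1 ^ 2)) + stateSum p (fullBoundary (C 1)) := by
  rw [← map_add, excursionSeries, mk_sum_filter_eq_stateSum p IsNExcursion (weight p)
    (fun σ => match σ with | even 0 _ => 1 | full 0 _ => 1 | _ => 0)]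
  · congr 1
    funext σ
    rcases σ with _ | ⟨_ | m, k⟩ | ⟨_ | m, e⟩ <;> simp [evenBoundary, fullBoundary]
  · intro n w h
    generalize walkState w = σ at h
    rcases σ with _ | ⟨_ | m, k⟩ | ⟨_ | m, e⟩
    · simp [not_isNExcursion_of_dead h]
    · simp [isNExcursion_of_even_iff h, weight]
    · simp [isNExcursion_of_even_iff h]
    · simp [isNExcursion_of_full_iff h, weight]
    · simp [isNExcursion_of_full_iff h]

theorem xyMonomial_weight_even {n : ℕ} {w : Fin n → Finset ℤ} {m k : ℕ}
    (h : reachPlus w = (even m k).toSet) :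
    xyMonomial (weight p w) (minPlus w) (maxPlus w) = (∏ i, MvPolynomial.C (p (w i))) *
      ((MvPolynomial.X 0 * MvPolynomial.X 1) ^ m * (MvPolynomial.X 1 ^ 2) ^ k) := by
  have h1 : ((m : ℤ) + 2 * k).toNat = m + 2 * k := by omega
  rw [(minPlus_maxPlus_of_even h).1, (minPlus_maxPlus_of_even h).2, xyMonomial, h1, weight,
    map_prod, Int.toNat_natCast]
  ring

theorem xyMonomial_weight_full {n : ℕ} {w : Fin n → Finset ℤ} {m e : ℕ}
    (h : reachPlus w = (full m e).toSet) :
    xyMonomial (weight p w) (minPlus w) (maxPlus w - 1) = (∏ i, MvPolynomial.C (p (w i))) *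
      ((MvPolynomial.X 0 * MvPolynomial.X 1) ^ m * MvPolynomial.X 1 ^ e) := by
  have h1 : ((m : ℤ) + e + 1 - 1).toNat = m + e := by omega
  rw [(minPlus_maxPlus_of_full h).1, (minPlus_maxPlus_of_full h).2, xyMonomial, h1, weight,
    map_prod, Int.toNat_natCast]
  ring

theorem xyMonomial_weight_full' {n : ℕ} {w : Fin n → Finset ℤ} {m e : ℕ}
    (h : reachPlus w = (full m e).toSet) :
    xyMonomial (weight p w) (minPlus w) (maxPlus w) = (∏ i, MvPolynomial.C (p (w i))) *
      ((MvPolynomial.X 0 * MvPolynomial.X 1) ^ m * MvPolynomial.X 1 ^ (e + 1)) := by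
  have h1 : ((m : ℤ) + e + 1).toNat = m + e + 1 := by omega
  rw [(minPlus_maxPlus_of_full h).1, (minPlus_maxPlus_of_full h).2, xyMonomial, h1, weight,
    map_prod, Int.toNat_natCast]
  ring

theorem meanderSeriesType1_eq :
    meanderSeriesType1 p = stateSum (fun s => MvPolynomial.C (p s))
      (evenAll (C (MvPolynomial.X 0 * MvPolynomial.X 1)) (C (MvPolynomial.X 1) ^ 2)) := by
  rw [meanderSeriesType1, mk_sum_filter_eq_stateSum (fun s => MvPolynomial.C (p s))
    IsNMeanderType1 (fun w => xyMonomial (weight p w) (minPlus w) (maxPlus w))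
    (fun σ => match σ with
      | even m k => (MvPolynomial.X 0 * MvPolynomial.X 1) ^ m * (MvPolynomial.X 1 ^ 2) ^ k
      | _ => 0)]
  · congr 1
    funext σ
    rcases σ with _ | ⟨m, k⟩ | ⟨m, e⟩ <;> simp [evenAll]
  · intro n w h
    generalize walkState w = σ at h
    rcases σ with _ | ⟨m, k⟩ | ⟨m, e⟩
    · rw [if_neg fun h' => not_isNMeander_of_dead h h'.1, mul_zero]
    · rw [if_pos (isNMeanderType1_of_even h), xyMonomial_weight_even p h]
    · rw [if_neg (not_isNMeanderType1_of_full h), mul_zero]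

theorem meanderSeriesType2_eq :
    meanderSeriesType2 p = stateSum (fun s => MvPolynomial.C (p s))
      (fullAll (C (MvPolynomial.X 0 * MvPolynomial.X 1)) (C (MvPolynomial.X 1))) := by
  rw [meanderSeriesType2, mk_sum_filter_eq_stateSum (fun s => MvPolynomial.C (p s))
    IsNMeanderType2 (fun w => xyMonomial (weight p w) (minPlus w) (maxPlus w - 1))
    (fun σ => match σ with
      | full m e => (MvPolynomial.X 0 * MvPolynomial.X 1) ^ m * MvPolynomial.X 1 ^ e
      | _ => 0)]
  · congr 1
    funext σ
    rcases σ with _ | ⟨m, k⟩ | ⟨m, e⟩ <;> simp [fullAll]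
  · intro n w h
    generalize walkState w = σ at h
    rcases σ with _ | ⟨m, k⟩ | ⟨m, e⟩
    · rw [if_neg fun h' => not_isNMeander_of_dead h h'.1, mul_zero]
    · rw [if_neg (not_isNMeanderType2_of_even h), mul_zero]
    · rw [if_pos (isNMeanderType2_of_full h), xyMonomial_weight_full p h]

/-- Each Motzkin N-meander has exactly one type; the factor y restores the exponent max - 1 of type
2 to max. -/
theorem meanderSeriesXY_eq :
    meanderSeriesXY p = meanderSeriesType1 p + C (MvPolynomial.X 1) * meanderSeriesType2 p := by
  rw [meanderSeriesType1_eq, meanderSeriesType2_eq,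
    ← smul_eq_mul (C (MvPolynomial.X 1)) (stateSum _ _), ← map_smul, ← map_add,
    meanderSeriesXY, mk_sum_filter_eq_stateSum (fun s => MvPolynomial.C (p s))
    IsNMeander (fun w => xyMonomial (weight p w) (minPlus w) (maxPlus w))
    (fun σ => match σ with
      | dead => 0
      | even m k => (MvPolynomial.X 0 * MvPolynomial.X 1) ^ m * (MvPolynomial.X 1 ^ 2) ^ k
      | full m e => (MvPolynomial.X 0 * MvPolynomial.X 1) ^ m * MvPolynomial.X 1 ^ (e + 1))]
  · congr 1
    funext σ
    rcases σ with _ | ⟨m, k⟩ | ⟨m, e⟩ <;> simp [evenAll, fullAll]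
    ring
  · intro n w h
    generalize walkState w = σ at h
    rcases σ with _ | ⟨m, k⟩ | ⟨m, e⟩
    · rw [if_neg (not_isNMeander_of_dead h), mul_zero]
    · rw [if_pos (isNMeander_of_even h), xyMonomial_weight_even p h]
    · rw [if_pos (isNMeander_of_full h), xyMonomial_weight_full' p h]

end Series

end NWalk
end

theorem mainTheorem7 {K : Type*} [Field K] [CharZero K] (p : Finset ℤ → K) :
    IsAlgebraic (Polynomial K) (NWalk.meanderSeries p) ∧
    IsAlgebraic (Polynomial K) (NWalk.excursionSeries p) ∧
    IsAlgebraic (Polynomial (MvPolynomial (Fin 2) K)) (NWalk.meanderSeriesXY p) ∧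
    IsAlgebraic (Polynomial (MvPolynomial (Fin 2) K)) (NWalk.meanderSeriesType1 p) ∧
    IsAlgebraic (Polynomial (MvPolynomial (Fin 2) K)) (NWalk.meanderSeriesType2 p) := by
  -- The univariate series are treated directly with y = z = 1 over K, rather than by specializing
  -- an algebraic equation over K[x, y], which could degenerate.
  obtain ⟨ha, hb, hc, hd⟩ := NWalk.stateSum_mem p two_ne_zero one_ne_zero one_ne_zero
  obtain ⟨-, -, h1, h2⟩ := NWalk.stateSum_mem (R := MvPolynomial (Fin 2) K)
    (fun s => MvPolynomial.C (p s)) two_ne_zero (MvPolynomial.X_ne_zero 1)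
    (mul_ne_zero (MvPolynomial.X_ne_zero 0) (MvPolynomial.X_ne_zero 1))
  rw [← NWalk.meanderSeriesType1_eq] at h1
  rw [← NWalk.meanderSeriesType2_eq] at h2
  refine ⟨?_, ?_, ?_, h1, h2⟩
  · rw [NWalk.meanderSeries_eq]
    exact add_mem hc hd
  · rw [NWalk.excursionSeries_eq]
    exact add_mem ha hb
  · rw [NWalk.meanderSeriesXY_eq]
    exact add_mem h1 (mul_mem (NWalk.C_mem_algebraicSeries _) h2)
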